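/- Let $\mathcal X$ be a finite set and let $\mathsf P_1,\mathsf P_2$ be probability distributions on $\mathcal X$ with the same support. For $\lambda\in[0,1]$ let $\mathsf P^{(\lambda)}(x)=\mathsf P_1(x)^{1-\lambda}\mathsf P_2(x)^{\lambda}/\sum_{a}\mathsf P_1(a)^{1-\lambda}\mathsf P_2(a)^{\lambda}$, and let $D(P\|Q)=\sum_x P(x)\log\frac{P(x)}{Q(x)}$. A hypothesis test observes samples $X_1,X_2,\dots$ that are i.i.d. with law $\mathsf P_1$ (under $H_1$) or $\mathsf P_2$ (under $H_2$). It consists of a stopping time $\tau$ of the filtration $\sigma(X_1,\dots,X_n)$ and, for each $k$, a partition of $\mathcal X^{k}$ into $A_1^{k}$ (accept $H_1$) and $A_2^{k}$ (accept $H_2$), used when $\tau=k$. For $\gamma\ge 0$ and an integer $K\ge1$, a pair $(E_1,E_2)\in\mathbb R^2$ is achievable in a $(\gamma,K)$-almost-fixed-length manner if for every $\delta>0$ there is $N$ such that for all $n\ge N$ there is a test with $$\mathsf P_i(\tau>n)\le e^{-\gamma n}\ \text{ and }\ \tau\le Kn\ \ \mathsf P_i\text{-a.s.}\quad (i=1,2),\qquad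 \mathsf P_1(A_2^{\tau})\le e^{-(E_1-\delta)n},\qquad \mathsf P_2(A_1^{\tau})\le e^{-(E_2-\delta)n}.$$ Let $\mathcal R_{\mathrm{AFL}}^{(\gamma,K)}$ be the set of all such pairs. Let $\mathcal R_{\mathrm{FL}}$ be the set of pairs achievable in a fixed-length manner, which is defined in the same way with the conditions on $\tau$ replaced by $\tau\le n$ $\mathsf P_i$-a.s. for $i=1,2$. For $\gamma\ge 0$ put $$E_1(\gamma)=\max_{\lambda\in[0,1]}\{D(\mathsf P^{(\lambda)}\|\mathsf P_1): D(\mathsf P^{(\lambda)}\|\mathsf P_2)\ge\gamma\},\qquad E_2(\gamma)=\max_{\lambda\in[0,1]}\{D(\mathsf P^{(\lambda)}\|\mathsf P_2): D(\mathsf P^{(\lambda)}\|\mathsf P_1)\ge\gamma\}$$ (with $\max\emptyset=-\infty$), and $$\mathcal R_\gamma=\mathcal R_{\mathrm{FL}}\cup\big(\{E_1:E_1\le E_1(\gamma)\}\times\{E_2:E_2\le E_2(\gamma)\}\big).$$ Theorem. First, $$\mathcal R_{\mathrm{FL}}=\{(E_1,E_2): E_i\le D(\mathsf P^{(\lambda)}\|\mathsf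 P_i),\ i=1,2,\text{ for some }\lambda\in[0,1]\}\ \cup\ \{(E_1,E_2): E_1\le 0\text{ or }E_2\le 0\}.$$ Secondly, for every integer $K\ge 1$ and every real $\gamma\ge 0$, $$\mathcal R_\gamma\cap K\mathcal R_{\mathrm{FL}}\subset\mathcal R_{\mathrm{AFL}}^{(\gamma,K)},$$ and conversely, for every integer $K\ge1$ and every real $\gamma>0$, $$\mathcal R_{\mathrm{AFL}}^{(\gamma,K)}\subset\mathcal R_\gamma\cap K\mathcal R_{\mathrm{FL}}.$$ -/

import Mathlib

open MeasureTheory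
open scoped Pointwise

namespace AFLTest

noncomputable section

variable {𝒳 : Type*}

/-- The filtration `σ(X₁, …, Xₙ)`, `n ≥ 0`, on the space of sample sequences
`x = (x 0, x 1, …)`; the `n`-th σ-algebra is generated by the first `n` coordinates. -/
def sampleFiltration (𝒳 : Type*) [MeasurableSpace 𝒳] :
    Filtration ℕ (MeasurableSpace.pi : MeasurableSpace (ℕ → 𝒳)) where
  seq n := MeasurableSpace.comap (fun (x : ℕ → 𝒳) (i : Fin n) => x i) MeasurableSpace.pi
  mono' := by
    intro m n hmn
    have hmeas : Measurable (fun (y : Fin n → 𝒳) (i : Fin m) => y (Fin.castLE hmn i)) :=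
      measurable_pi_lambda _ fun i => measurable_pi_apply _
    have hcomp : (fun (x : ℕ → 𝒳) (i : Fin m) => x i) =
        (fun (y : Fin n → 𝒳) (i : Fin m) => y (Fin.castLE hmn i)) ∘
          (fun (x : ℕ → 𝒳) (i : Fin n) => x i) := rfl
    change MeasurableSpace.comap _ _ ≤ MeasurableSpace.comap _ _
    rw [hcomp, ← MeasurableSpace.comap_comp]
    exact MeasurableSpace.comap_mono hmeas.comap_le
  le' n := (measurable_pi_lambda (fun (x : ℕ → 𝒳) (i : Fin n) => x i)
    fun i => measurable_pi_apply _).comap_le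

/-- The law of an i.i.d. sequence of samples with common distribution `P`. -/
def seqLaw [MeasurableSpace 𝒳] (P : Measure 𝒳) : Measure (ℕ → 𝒳) :=
  Measure.infinitePi fun _ : ℕ => P

/-- A hypothesis test: a stopping time `τ` of the sample filtration, and for every `k` a decision
region `A₁ k ⊆ 𝒳ᵏ` on which the test, stopped after `k` samples, accepts `H₁`. -/
structure HypTest (𝒳 : Type*) [MeasurableSpace 𝒳] where
  /-- the number of collected samples -/
  τ : (ℕ → 𝒳) → WithTop ℕ
  isStoppingTime : IsStoppingTime (sampleFiltration 𝒳) τ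
  /-- the region of acceptance of `H₁` after `k` samples -/
  A₁ : (k : ℕ) → Set (Fin k → 𝒳)

namespace HypTest

variable [MeasurableSpace 𝒳]

/-- The region of acceptance of `H₂` after `k` samples. -/
def A₂ (T : HypTest 𝒳) (k : ℕ) : Set (Fin k → 𝒳) := (T.A₁ k)ᶜ

/-- The event that the test stops and accepts `H₁`. -/
def accept₁ (T : HypTest 𝒳) : Set (ℕ → 𝒳) :=
  {x | ∃ k : ℕ, T.τ x = (k : WithTop ℕ) ∧ (fun i : Fin k => x i) ∈ T.A₁ k}

/-- The event that the test stops and accepts `H₂`. -/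
def accept₂ (T : HypTest 𝒳) : Set (ℕ → 𝒳) :=
  {x | ∃ k : ℕ, T.τ x = (k : WithTop ℕ) ∧ (fun i : Fin k => x i) ∈ T.A₂ k}

end HypTest

section Regions

variable [MeasurableSpace 𝒳]

/-- The set `R_FL` of pairs of error exponents achievable in a fixed-length manner. -/
def fixedLengthRegion (P₁ P₂ : Measure 𝒳) : Set (ℝ × ℝ) :=
  {E | ∀ δ : ℝ, 0 < δ → ∃ N : ℕ, ∀ n : ℕ, N ≤ n → ∃ T : HypTest 𝒳,
    (∀ᵐ x ∂(seqLaw P₁), T.τ x ≤ (n : WithTop ℕ)) ∧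
    (∀ᵐ x ∂(seqLaw P₂), T.τ x ≤ (n : WithTop ℕ)) ∧
    (seqLaw P₁).real T.accept₂ ≤ Real.exp (-(E.1 - δ) * n) ∧
    (seqLaw P₂).real T.accept₁ ≤ Real.exp (-(E.2 - δ) * n)}

/-- The set `R_AFL^{(γ,K)}` of pairs of error exponents achievable in a
`(γ, K)`-almost-fixed-length manner. -/
def almostFixedLengthRegion (P₁ P₂ : Measure 𝒳) (γ : ℝ) (K : ℕ) : Set (ℝ × ℝ) :=
  {E | ∀ δ : ℝ, 0 < δ → ∃ N : ℕ, ∀ n : ℕ, N ≤ n → ∃ T : HypTest 𝒳,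
    (seqLaw P₁).real {x | (n : WithTop ℕ) < T.τ x} ≤ Real.exp (-γ * n) ∧
    (seqLaw P₂).real {x | (n : WithTop ℕ) < T.τ x} ≤ Real.exp (-γ * n) ∧
    (∀ᵐ x ∂(seqLaw P₁), T.τ x ≤ ((K * n : ℕ) : WithTop ℕ)) ∧
    (∀ᵐ x ∂(seqLaw P₂), T.τ x ≤ ((K * n : ℕ) : WithTop ℕ)) ∧
    (seqLaw P₁).real T.accept₂ ≤ Real.exp (-(E.1 - δ) * n) ∧
    (seqLaw P₂).real T.accept₁ ≤ Real.exp (-(E.2 - δ) * n)}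

/-- The probability mass function of a distribution. -/
def pmf (P : Measure 𝒳) (x : 𝒳) : ℝ := P.real {x}

variable [Fintype 𝒳]

/-- The Kullback–Leibler divergence `∑ p(x) log (p(x) / q(x))`, for mass functions `p`, `q` such
that `q(x) = 0` implies `p(x) = 0`. -/
def kl (p q : 𝒳 → ℝ) : ℝ := ∑ x, p x * Real.log (p x / q x)

/-- The `l`-tilted distribution `P^{(l)}` with respect to `P₁` and `P₂`. -/
def tilted (P₁ P₂ : Measure 𝒳) (l : ℝ) (x : 𝒳) : ℝ :=
  (pmf P₁ x ^ (1 - l) * pmf P₂ x ^ l) / ∑ a, pmf P₁ a ^ (1 - l) * pmf P₂ a ^ l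

/-- The pairs that are dominated by `(D(P^{(l)}‖P₁), D(P^{(l)}‖P₂))` for some `l ∈ [0,1]`. -/
def tiltedRegion (P₁ P₂ : Measure 𝒳) : Set (ℝ × ℝ) :=
  {E | ∃ l ∈ Set.Icc (0 : ℝ) 1,
    E.1 ≤ kl (tilted P₁ P₂ l) (pmf P₁) ∧ E.2 ≤ kl (tilted P₁ P₂ l) (pmf P₂)}

/-- `E₁(γ) = max {D(P^{(l)}‖P₁) : l ∈ [0,1], D(P^{(l)}‖P₂) ≥ γ}`, with `max ∅ = -∞`. -/
def E₁ (P₁ P₂ : Measure 𝒳) (γ : ℝ) : EReal :=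
  sSup {e : EReal | ∃ l ∈ Set.Icc (0 : ℝ) 1,
    γ ≤ kl (tilted P₁ P₂ l) (pmf P₂) ∧ e = ((kl (tilted P₁ P₂ l) (pmf P₁) : ℝ) : EReal)}

/-- `E₂(γ) = max {D(P^{(l)}‖P₂) : l ∈ [0,1], D(P^{(l)}‖P₁) ≥ γ}`, with `max ∅ = -∞`. -/
def E₂ (P₁ P₂ : Measure 𝒳) (γ : ℝ) : EReal :=
  sSup {e : EReal | ∃ l ∈ Set.Icc (0 : ℝ) 1,
    γ ≤ kl (tilted P₁ P₂ l) (pmf P₁) ∧ e = ((kl (tilted P₁ P₂ l) (pmf P₂) : ℝ) : EReal)}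

/-- The region `R_γ`: the union of `R_FL` and `{E₁ ≤ E₁(γ)} × {E₂ ≤ E₂(γ)}`. -/
def Rγ (P₁ P₂ : Measure 𝒳) (γ : ℝ) : Set (ℝ × ℝ) :=
  fixedLengthRegion P₁ P₂ ∪
    {a : ℝ | (a : EReal) ≤ E₁ P₁ P₂ γ} ×ˢ {b : ℝ | (b : EReal) ≤ E₂ P₁ P₂ γ}

end Regions

end

end AFLTest

set_option linter.unusedSectionVars false

/-! On finite samples everything is a comparison of the product laws of `P₁`, `P₂` and the tilted
law Q = P^(l). Both log(Q/P₁) and log(Q/P₂) are affine in the log-likelihood ratio, with slopes l ≥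
0 and l - 1 ≤ 0. Thresholding that ratio at its Q-mean therefore gives error exponents D(Q‖P₁) and
D(Q‖P₂). Conversely, a test beating both exponents would give both of its decision regions vanishing
Q-mass (`exists_mass_le_exp_mul_mass`). So for every l at least one of the two bounds holds, and
connectedness of [0,1] yields an l for which both hold when the exponents are positive.

For the almost-fixed-length converse, truncate at time n and assign the undecided runs to one
hypothesis: only one error grows, by at most exp(-γn), so (E₁, min(E₂, γ)) and its mirror image lie
in the fixed-length region. Since the test never exceeds Kn samples, E/K lies there as well.

For achievability, run two threshold tests at time n. The one tuned to l₁ may decide for H₂, the one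
tuned to l₂ for H₁; if neither decides, a fixed-length test on Kn samples does. The constraints
defining E₁(γ) and E₂(γ) bound the probability of continuing. -/

namespace AFLTest

/-! ### Product mass functions, a Chernoff bound and change of measure -/

section Mass

variable {𝒳 : Type*} [Fintype 𝒳]

/-- The mass that the `n`-fold product of the mass function `p` gives to `B`. -/
noncomputable def mass (p : 𝒳 → ℝ) (n : ℕ) (B : Set (Fin n → 𝒳)) : ℝ :=
  ∑ y, B.indicator (fun y => ∏ i, p (y i)) y

variable {p q : 𝒳 → ℝ} {n : ℕ} {B C : Set (Fin n → 𝒳)}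

lemma mass_mono (hp : ∀ x, 0 ≤ p x) (h : B ⊆ C) : mass p n B ≤ mass p n C :=
  Finset.sum_le_sum fun y _ =>
    Set.indicator_le_indicator_of_subset h (fun _ => Finset.prod_nonneg fun _ _ => hp _) y

lemma mass_empty : mass p n ∅ = 0 := by simp [mass]

lemma mass_univ (h1 : ∑ x, p x = 1) : mass p n Set.univ = 1 := by
  simp [mass, ← Fintype.sum_pow, h1]

lemma mass_add_compl (h1 : ∑ x, p x = 1) : mass p n B + mass p n Bᶜ = 1 := by
  rw [← mass_univ (n := n) h1, mass, mass, mass, ← Finset.sum_add_distrib]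
  simp [Set.indicator_self_add_compl_apply]

lemma mass_le_one (hp : ∀ x, 0 ≤ p x) (h1 : ∑ x, p x = 1) : mass p n B ≤ 1 :=
  (mass_mono hp (Set.subset_univ B)).trans_eq (mass_univ h1)

lemma mass_union_le (hp : ∀ x, 0 ≤ p x) : mass p n (B ∪ C) ≤ mass p n B + mass p n C := by
  rw [mass, mass, mass, ← Finset.sum_add_distrib]
  refine Finset.sum_le_sum fun y _ => ?_
  have h : 0 ≤ ∏ i, p (y i) := Finset.prod_nonneg fun _ _ => hp _
  by_cases hB : y ∈ B <;> by_cases hC : y ∈ C <;> simp [hB, hC, h]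

lemma mass_le_mul_mass {c : ℝ} (h : ∀ y ∈ B, ∏ i, p (y i) ≤ c * ∏ i, q (y i)) :
    mass p n B ≤ c * mass q n B := by
  rw [mass, mass, Finset.mul_sum]
  refine Finset.sum_le_sum fun y _ => ?_
  by_cases hB : y ∈ B
  · simpa [hB] using h y hB
  · simp [hB]

/-- A one-sided large deviation bound: sample means exceed a value above the expectation with
exponentially small probability. -/
lemma exists_mass_sum_ge_le (hq : ∀ x, 0 ≤ q x) (h1 : ∑ x, q x = 1) (f : 𝒳 → ℝ) {c : ℝ}
    (hc : ∑ x, q x * f x < c) :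
    ∃ r : ℝ, 0 ≤ r ∧ r < 1 ∧
      ∀ n : ℕ, mass q n {y : Fin n → 𝒳 | n * c ≤ ∑ i, f (y i)} ≤ r ^ n := by
  -- Chernoff: the moment generating function `g` of f - c has value 1 and negative derivative at 0,
  -- so `g s < 1` for some s > 0; this value is r.
  set g : ℝ → ℝ := fun s => ∑ x, q x * Real.exp (s * (f x - c)) with hg
  have hg0 : g 0 = 1 := by simp [hg, h1]
  have hder : HasDerivAt g (∑ x, q x * (f x - c)) 0 := by
    refine HasDerivAt.fun_sum fun x _ => ?_
    have := (((hasDerivAt_id (0 : ℝ)).mul_const (f x - c)).exp).const_mul (q x)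
    simpa using this
  have hneg : ∑ x, q x * (f x - c) < 0 := by
    simp only [mul_sub, Finset.sum_sub_distrib, ← Finset.sum_mul, h1]
    linarith
  have hev := (hasDerivAt_iff_tendsto_slope.1 hder).eventually_lt_const hneg
  have hev' : ∀ᶠ s in nhdsWithin (0 : ℝ) (Set.Ioi 0), slope g 0 s < 0 :=
    hev.filter_mono (nhdsWithin_mono _ fun s hs => ne_of_gt hs)
  obtain ⟨s, hs, hs0⟩ := (hev'.and self_mem_nhdsWithin).exists
  have hs0 : 0 < s := hs0
  refine ⟨g s, Finset.sum_nonneg fun x _ => mul_nonneg (hq x) (Real.exp_pos _).le, ?_, ?_⟩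
  · rw [slope_def_field, hg0, sub_zero, div_neg_iff] at hs
    rcases hs with h | h <;> linarith
  · intro n
    rw [hg]
    simp only []
    -- `g s ^ n` expands over all sequences, with an exponential weight that is at least 1 on the
    -- event.
    rw [Fintype.sum_pow, mass]
    refine Finset.sum_le_sum fun y _ => ?_
    have h0 : 0 ≤ ∏ i, q (y i) := Finset.prod_nonneg fun _ _ => hq _
    rw [Finset.prod_mul_distrib, ← Real.exp_sum, ← Finset.mul_sum, Finset.sum_sub_distrib]
    by_cases hB : y ∈ {y : Fin n → 𝒳 | n * c ≤ ∑ i, f (y i)}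
    · rw [Set.indicator_of_mem hB]
      refine le_mul_of_one_le_right h0 (Real.one_le_exp (mul_nonneg hs0.le ?_))
      have : (n : ℝ) * c ≤ ∑ i, f (y i) := hB
      simpa using this
    · rw [Set.indicator_of_notMem hB]
      exact mul_nonneg h0 (Real.exp_pos _).le

lemma prod_eq_prod_mul_exp (y : Fin n → 𝒳) (hp : ∀ i, 0 < p (y i)) (hq : ∀ i, 0 < q (y i)) :
    ∏ i, q (y i) = Real.exp (∑ i, Real.log (q (y i) / p (y i))) * ∏ i, p (y i) := by
  rw [Real.exp_sum, ← Finset.prod_mul_distrib]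
  refine Finset.prod_congr rfl fun i _ => ?_
  rw [Real.exp_log (div_pos (hq i) (hp i)), div_mul_cancel₀ _ (hp i).ne']

/-- Change of measure: events that are typical for `q` have `p`-probability at least about
`exp (-n D(q‖p))`. -/
lemma exists_mass_le_exp_mul_mass (hp : ∀ x, 0 ≤ p x) (hq : ∀ x, 0 ≤ q x) (h1 : ∑ x, q x = 1)
    (hac : ∀ x, p x = 0 → q x = 0) {c : ℝ} (hc : kl q p < c) :
    ∃ r : ℝ, 0 ≤ r ∧ r < 1 ∧
      ∀ (n : ℕ) (B : Set (Fin n → 𝒳)), mass q n B ≤ Real.exp (c * n) * mass p n B + r ^ n := by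
  obtain ⟨r, hr0, hr1, hr⟩ := exists_mass_sum_ge_le hq h1 (fun x => Real.log (q x / p x)) hc
  refine ⟨r, hr0, hr1, fun n B => ?_⟩
  -- `D` is atypical for q because c exceeds the mean `kl q p`, so it costs only `r ^ n`. Off `D`
  -- the density of q with respect to p is below exp(cn).
  set D : Set (Fin n → 𝒳) := {y | n * c ≤ ∑ i, Real.log (q (y i) / p (y i))} with hD
  calc mass q n B ≤ mass q n ((B ∩ Dᶜ) ∪ D) := mass_mono hq fun y hy => by
        by_cases h : y ∈ D
        · exact Or.inr h
        · exact Or.inl ⟨hy, h⟩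
    _ ≤ mass q n (B ∩ Dᶜ) + mass q n D := mass_union_le hq
    _ ≤ Real.exp (c * n) * mass p n (B ∩ Dᶜ) + r ^ n := by
        refine add_le_add (mass_le_mul_mass ?_) (hr n)
        rintro y ⟨-, hy⟩
        have hpy : 0 ≤ ∏ i, p (y i) := Finset.prod_nonneg fun _ _ => hp _
        -- Sequences of zero q-mass are treated apart, since the logarithm of the ratio is a genuine
        -- density exponent only at positive masses.
        by_cases h0 : ∃ i, q (y i) = 0
        · obtain ⟨i, hi⟩ := h0
          rw [Finset.prod_eq_zero (Finset.mem_univ i) hi]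
          exact mul_nonneg (Real.exp_pos _).le hpy
        · push Not at h0
          rw [prod_eq_prod_mul_exp y (fun i => (hp _).lt_of_ne fun h => h0 i (hac _ h.symm))
            (fun i => (hq _).lt_of_ne (h0 i).symm)]
          refine mul_le_mul_of_nonneg_right (Real.exp_le_exp.2 ?_) hpy
          simp only [hD, Set.mem_compl_iff, Set.mem_ofPred_eq, not_le] at hy
          linarith
    _ ≤ Real.exp (c * n) * mass p n B + r ^ n := by
        gcongr
        exact mass_mono hp Set.inter_subset_left

end Mass

/-! ### The tilted family and log-likelihood ratio tests -/

section Tilted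

variable {𝒳 : Type*} [Fintype 𝒳] [MeasurableSpace 𝒳] [MeasurableSingletonClass 𝒳]

lemma pmf_nonneg (P : Measure 𝒳) (x : 𝒳) : 0 ≤ pmf P x := measureReal_nonneg

lemma sum_pmf (P : Measure 𝒳) [IsProbabilityMeasure P] : ∑ x, pmf P x = 1 := by
  simp [pmf]

lemma pmf_eq_zero_of_ac {P Q : Measure 𝒳} [IsProbabilityMeasure P] [IsProbabilityMeasure Q]
    (h : P ≪ Q) {x : 𝒳} (hx : pmf Q x = 0) : pmf P x = 0 := by
  rw [pmf, measureReal_eq_zero_iff] at *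
  exact h hx

variable (P₁ P₂ : Measure 𝒳) [IsProbabilityMeasure P₁] [IsProbabilityMeasure P₂]

/-- The normalisation constant of the tilted distribution. -/
noncomputable def tiltSum (l : ℝ) : ℝ := ∑ a, pmf P₁ a ^ (1 - l) * pmf P₂ a ^ l

/-- The log-likelihood ratio. -/
noncomputable def llr (x : 𝒳) : ℝ := Real.log (pmf P₂ x / pmf P₁ x)

variable {P₁ P₂}

lemma pmf_pos_of_ac (h₁₂ : P₁ ≪ P₂) {x : 𝒳} (hx : 0 < pmf P₁ x) : 0 < pmf P₂ x :=
  (pmf_nonneg _ _).lt_of_ne fun h => hx.ne' (pmf_eq_zero_of_ac h₁₂ h.symm)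

lemma tilt_nonneg (l : ℝ) (x : 𝒳) : 0 ≤ pmf P₁ x ^ (1 - l) * pmf P₂ x ^ l :=
  mul_nonneg (Real.rpow_nonneg (pmf_nonneg _ _) _) (Real.rpow_nonneg (pmf_nonneg _ _) _)

lemma tiltSum_pos (h₁₂ : P₁ ≪ P₂) (l : ℝ) : 0 < tiltSum P₁ P₂ l := by
  obtain ⟨x, hx⟩ : ∃ x, 0 < pmf P₁ x := by
    by_contra! h
    have := Finset.sum_nonpos (s := Finset.univ) fun x _ => h x
    rw [sum_pmf] at this
    linarith
  exact Finset.sum_pos' (fun x _ => tilt_nonneg l x) ⟨x, Finset.mem_univ x, mul_pos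
    (Real.rpow_pos_of_pos hx _) (Real.rpow_pos_of_pos (pmf_pos_of_ac h₁₂ hx) _)⟩

lemma tilted_nonneg (l : ℝ) (x : 𝒳) : 0 ≤ tilted P₁ P₂ l x :=
  div_nonneg (tilt_nonneg l x) (Finset.sum_nonneg fun x _ => tilt_nonneg l x)

lemma sum_tilted (h₁₂ : P₁ ≪ P₂) (l : ℝ) : ∑ x, tilted P₁ P₂ l x = 1 := by
  simp only [tilted]
  rw [← Finset.sum_div]
  exact div_self (tiltSum_pos h₁₂ l).ne'

lemma tilted_eq_zero (h₂₁ : P₂ ≪ P₁) (l : ℝ) {x : 𝒳} (hx : pmf P₁ x = 0) :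
    tilted P₁ P₂ l x = 0 := by
  rw [tilted, hx, pmf_eq_zero_of_ac h₂₁ hx]
  -- Since `0 ^ 0 = 1` for real powers, the vanishing factor is the one from `P₁` at l = 0 and the
  -- one from `P₂` otherwise.
  rcases eq_or_ne l 0 with rfl | hl
  · simp
  · simp [Real.zero_rpow hl]

lemma tilted_pos (h₁₂ : P₁ ≪ P₂) (l : ℝ) {x : 𝒳} (hx : 0 < pmf P₁ x) : 0 < tilted P₁ P₂ l x :=
  div_pos (mul_pos (Real.rpow_pos_of_pos hx _) (Real.rpow_pos_of_pos (pmf_pos_of_ac h₁₂ hx) _))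
    (tiltSum_pos h₁₂ l)

lemma log_tilted (h₁₂ : P₁ ≪ P₂) (l : ℝ) {x : 𝒳} (hx : 0 < pmf P₁ x) :
    Real.log (tilted P₁ P₂ l x) =
      (1 - l) * Real.log (pmf P₁ x) + l * Real.log (pmf P₂ x) - Real.log (tiltSum P₁ P₂ l) := by
  have hx₂ := pmf_pos_of_ac h₁₂ hx
  have hZ := tiltSum_pos h₁₂ l
  rw [tilted, ← tiltSum, Real.log_div (by positivity) hZ.ne',
    Real.log_mul (by positivity) (by positivity), Real.log_rpow hx, Real.log_rpow hx₂]

lemma log_tilted_div_left (h₁₂ : P₁ ≪ P₂) (l : ℝ) {x : 𝒳} (hx : 0 < pmf P₁ x) :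
    Real.log (tilted P₁ P₂ l x / pmf P₁ x) =
      l * llr P₁ P₂ x - Real.log (tiltSum P₁ P₂ l) := by
  have hx₂ := pmf_pos_of_ac h₁₂ hx
  rw [llr, Real.log_div (tilted_pos h₁₂ l hx).ne' hx.ne', log_tilted h₁₂ l hx,
    Real.log_div hx₂.ne' hx.ne']
  ring

lemma log_tilted_div_right (h₁₂ : P₁ ≪ P₂) (l : ℝ) {x : 𝒳} (hx : 0 < pmf P₁ x) :
    Real.log (tilted P₁ P₂ l x / pmf P₂ x) =
      (l - 1) * llr P₁ P₂ x - Real.log (tiltSum P₁ P₂ l) := by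
  have hx₂ := pmf_pos_of_ac h₁₂ hx
  rw [llr, Real.log_div (tilted_pos h₁₂ l hx).ne' hx₂.ne', log_tilted h₁₂ l hx,
    Real.log_div hx₂.ne' hx.ne']
  ring

variable (P₁ P₂) in
/-- The mean of the log-likelihood ratio under the tilted distribution. -/
noncomputable def meanLlr (l : ℝ) : ℝ := ∑ x, tilted P₁ P₂ l x * llr P₁ P₂ x

/-- The tilted law charges only the common support, so an affine formula valid there can be
averaged. This turns both divergences into affine functions of `meanLlr`. -/
lemma sum_tilted_mul_eq (h₁₂ : P₁ ≪ P₂) (h₂₁ : P₂ ≪ P₁) (l a b : ℝ) {f : 𝒳 → ℝ}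
    (hf : ∀ x, 0 < pmf P₁ x → f x = a * llr P₁ P₂ x - b) :
    ∑ x, tilted P₁ P₂ l x * f x = a * meanLlr P₁ P₂ l - b := by
  rw [meanLlr, Finset.mul_sum, ← mul_one b, ← sum_tilted h₁₂ l, Finset.mul_sum,
    ← Finset.sum_sub_distrib]
  refine Finset.sum_congr rfl fun x _ => ?_
  rcases (pmf_nonneg P₁ x).eq_or_lt with h | h
  · simp [tilted_eq_zero h₂₁ l h.symm]
  · rw [hf x h]
    ring

lemma kl_tilted_left (h₁₂ : P₁ ≪ P₂) (h₂₁ : P₂ ≪ P₁) (l : ℝ) :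
    kl (tilted P₁ P₂ l) (pmf P₁) = l * meanLlr P₁ P₂ l - Real.log (tiltSum P₁ P₂ l) :=
  sum_tilted_mul_eq h₁₂ h₂₁ l _ _ fun _ hx => log_tilted_div_left h₁₂ l hx

lemma kl_tilted_right (h₁₂ : P₁ ≪ P₂) (h₂₁ : P₂ ≪ P₁) (l : ℝ) :
    kl (tilted P₁ P₂ l) (pmf P₂) = (l - 1) * meanLlr P₁ P₂ l - Real.log (tiltSum P₁ P₂ l) :=
  sum_tilted_mul_eq h₁₂ h₂₁ l _ _ fun _ hx => log_tilted_div_right h₁₂ l hx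

lemma tiltSum_zero : tiltSum P₁ P₂ 0 = 1 := by simp [tiltSum, sum_pmf]

lemma tiltSum_one : tiltSum P₁ P₂ 1 = 1 := by simp [tiltSum, sum_pmf]

lemma kl_tilted_zero (h₁₂ : P₁ ≪ P₂) (h₂₁ : P₂ ≪ P₁) : kl (tilted P₁ P₂ 0) (pmf P₁) = 0 := by
  simp [kl_tilted_left h₁₂ h₂₁, tiltSum_zero]

lemma kl_tilted_one (h₁₂ : P₁ ≪ P₂) (h₂₁ : P₂ ≪ P₁) : kl (tilted P₁ P₂ 1) (pmf P₂) = 0 := by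
  simp [kl_tilted_right h₁₂ h₂₁, tiltSum_one]

/-- Off the support each power of 0 jumps at an endpoint of [0,1], but the product is identically
zero. -/
lemma continuous_tilt (h₁₂ : P₁ ≪ P₂) (h₂₁ : P₂ ≪ P₁) (x : 𝒳) :
    Continuous fun l : ℝ => pmf P₁ x ^ (1 - l) * pmf P₂ x ^ l := by
  rcases (pmf_nonneg P₁ x).eq_or_lt with h | h
  · have h0 : ∀ l : ℝ, pmf P₁ x ^ (1 - l) * pmf P₂ x ^ l = 0 := fun l => by
      have := tilted_eq_zero h₂₁ l h.symm
      exact (div_eq_zero_iff.1 this).resolve_right (tiltSum_pos h₁₂ l).ne'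
    simp only [h0]
    exact continuous_const
  · exact (Real.continuous_const_rpow h.ne').comp (continuous_const.sub continuous_id) |>.mul
      (Real.continuous_const_rpow (pmf_pos_of_ac h₁₂ h).ne')

lemma continuous_tiltSum (h₁₂ : P₁ ≪ P₂) (h₂₁ : P₂ ≪ P₁) : Continuous (tiltSum P₁ P₂) :=
  continuous_finsetSum _ fun x _ => continuous_tilt h₁₂ h₂₁ x

lemma continuous_meanLlr (h₁₂ : P₁ ≪ P₂) (h₂₁ : P₂ ≪ P₁) : Continuous (meanLlr P₁ P₂) :=
  continuous_finsetSum _ fun x _ => ((continuous_tilt h₁₂ h₂₁ x).div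
    (continuous_tiltSum h₁₂ h₂₁) fun l => (tiltSum_pos h₁₂ l).ne').mul continuous_const

lemma continuous_kl_tilted_left (h₁₂ : P₁ ≪ P₂) (h₂₁ : P₂ ≪ P₁) :
    Continuous fun l => kl (tilted P₁ P₂ l) (pmf P₁) := by
  simp only [kl_tilted_left h₁₂ h₂₁]
  exact (continuous_id.mul (continuous_meanLlr h₁₂ h₂₁)).sub
    ((continuous_tiltSum h₁₂ h₂₁).log fun l => (tiltSum_pos h₁₂ l).ne')

lemma continuous_kl_tilted_right (h₁₂ : P₁ ≪ P₂) (h₂₁ : P₂ ≪ P₁) :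
    Continuous fun l => kl (tilted P₁ P₂ l) (pmf P₂) := by
  simp only [kl_tilted_right h₁₂ h₂₁]
  exact ((continuous_id.sub continuous_const).mul (continuous_meanLlr h₁₂ h₂₁)).sub
    ((continuous_tiltSum h₁₂ h₂₁).log fun l => (tiltSum_pos h₁₂ l).ne')

/-- The samples for which the log-likelihood ratio test with threshold `meanLlr P₁ P₂ l`
accepts `H₁`. -/
def llrRegion (P₁ P₂ : Measure 𝒳) (l : ℝ) (n : ℕ) : Set (Fin n → 𝒳) :=
  {y | ∑ i, llr P₁ P₂ (y i) < n * meanLlr P₁ P₂ l}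

/-- On B the tilted density dominates exp(Dn) times that of p, and the total tilted mass is at most
1. -/
lemma mass_le_exp_of_tilted (h₁₂ : P₁ ≪ P₂) {l D : ℝ} {p : 𝒳 → ℝ} (hp : ∀ x, 0 ≤ p x)
    (hp₁ : ∀ x, 0 < p x → 0 < pmf P₁ x) {n : ℕ} {B : Set (Fin n → 𝒳)}
    (hB : ∀ y ∈ B, (∀ i, 0 < pmf P₁ (y i)) →
      D * n ≤ ∑ i, Real.log (tilted P₁ P₂ l (y i) / p (y i))) :
    mass p n B ≤ Real.exp (-D * n) := by
  calc mass p n B ≤ Real.exp (-D * n) * mass (tilted P₁ P₂ l) n B := by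
        refine mass_le_mul_mass fun y hy => ?_
        have h0 : 0 ≤ ∏ i, tilted P₁ P₂ l (y i) :=
          Finset.prod_nonneg fun _ _ => tilted_nonneg l _
        by_cases h : ∃ i, p (y i) = 0
        · obtain ⟨i, hi⟩ := h
          rw [Finset.prod_eq_zero (Finset.mem_univ i) hi]
          exact mul_nonneg (Real.exp_pos _).le h0
        · push Not at h
          have hpos : ∀ i, 0 < p (y i) := fun i => (hp _).lt_of_ne (h i).symm
          rw [prod_eq_prod_mul_exp (p := p) (q := tilted P₁ P₂ l) y hpos
            (fun i => tilted_pos h₁₂ l (hp₁ _ (hpos i))), ← mul_assoc, ← Real.exp_add]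
          refine le_mul_of_one_le_left (Finset.prod_nonneg fun _ _ => hp _) (Real.one_le_exp ?_)
          linarith [hB y hy fun i => hp₁ _ (hpos i)]
    _ ≤ Real.exp (-D * n) :=
        mul_le_of_le_one_right (Real.exp_pos _).le
          (mass_le_one (fun x => tilted_nonneg l x) (sum_tilted h₁₂ l))

/-- The slope l of log(P^(l)/P₁) in the log-likelihood ratio is nonnegative, so above the mean
threshold the summed exponent is at least n times its tilted mean, the divergence. -/
lemma mass_compl_llrRegion_le (h₁₂ : P₁ ≪ P₂) (h₂₁ : P₂ ≪ P₁) {l : ℝ} (hl : 0 ≤ l) (n : ℕ) :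
    mass (pmf P₁) n (llrRegion P₁ P₂ l n)ᶜ ≤
      Real.exp (-kl (tilted P₁ P₂ l) (pmf P₁) * n) := by
  refine mass_le_exp_of_tilted h₁₂ (l := l) (pmf_nonneg P₁) (fun _ h => h) fun y hy hpos => ?_
  rw [Finset.sum_congr rfl fun i _ => log_tilted_div_left h₁₂ l (hpos i),
    kl_tilted_left h₁₂ h₂₁, Finset.sum_sub_distrib, ← Finset.mul_sum]
  simp only [llrRegion, Set.mem_compl_iff, Set.mem_ofPred_eq, not_lt] at hy
  simp only [Finset.sum_const, Finset.card_univ, Fintype.card_fin, nsmul_eq_mul]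
  nlinarith [mul_le_mul_of_nonneg_left hy hl]

/-- Against `P₂` the slope is l - 1 ≤ 0, so the bound holds below the threshold. -/
lemma mass_llrRegion_le (h₁₂ : P₁ ≪ P₂) (h₂₁ : P₂ ≪ P₁) {l : ℝ} (hl : l ≤ 1) (n : ℕ) :
    mass (pmf P₂) n (llrRegion P₁ P₂ l n) ≤
      Real.exp (-kl (tilted P₁ P₂ l) (pmf P₂) * n) := by
  refine mass_le_exp_of_tilted h₁₂ (l := l) (pmf_nonneg P₂) (fun _ h => pmf_pos_of_ac h₂₁ h)
    fun y hy hpos => ?_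
  rw [Finset.sum_congr rfl fun i _ => log_tilted_div_right h₁₂ l (hpos i),
    kl_tilted_right h₁₂ h₂₁, Finset.sum_sub_distrib, ← Finset.mul_sum]
  simp only [llrRegion, Set.mem_ofPred_eq] at hy
  simp only [Finset.sum_const, Finset.card_univ, Fintype.card_fin, nsmul_eq_mul]
  nlinarith [mul_le_mul_of_nonneg_left hy.le (sub_nonneg.2 hl)]

end Tilted

/-! ### Infinite sample sequences, stopping and truncation of tests -/

section Sequences

variable {𝒳 : Type*} [Fintype 𝒳] [MeasurableSpace 𝒳] [MeasurableSingletonClass 𝒳]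

/-- The first `n` samples. -/
def firstSamples (n : ℕ) (x : ℕ → 𝒳) : Fin n → 𝒳 := fun i => x i

lemma measurable_firstSamples (n : ℕ) : Measurable (firstSamples (𝒳 := 𝒳) n) :=
  measurable_pi_lambda _ fun _ => measurable_pi_apply _

instance isProbabilityMeasure_seqLaw (P : Measure 𝒳) [IsProbabilityMeasure P] :
    IsProbabilityMeasure (seqLaw P) := by
  unfold seqLaw
  infer_instance

lemma seqLaw_singleton (P : Measure 𝒳) [IsProbabilityMeasure P] (n : ℕ) (y : Fin n → 𝒳) :
    (seqLaw P).real (firstSamples n ⁻¹' {y}) = ∏ i, pmf P (y i) := by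
  have hset : firstSamples n ⁻¹' {y} = Set.pi (Finset.range n)
      (fun j => if h : j < n then {y ⟨j, h⟩} else Set.univ) := by
    ext x
    simp only [Set.mem_preimage, Set.mem_singleton_iff, funext_iff, firstSamples, Set.mem_pi,
      Finset.coe_range, Set.mem_Iio]
    constructor
    · intro h j hj
      simpa [hj] using h ⟨j, hj⟩
    · intro h i
      simpa using h i i.2
  rw [hset, measureReal_def, seqLaw, Measure.infinitePi_pi _ fun j _ => .of_discrete,
    Finset.prod_range, ENNReal.toReal_prod]
  simp [pmf, measureReal_def]

lemma seqLaw_real_preimage (P : Measure 𝒳) [IsProbabilityMeasure P] (n : ℕ)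
    (B : Set (Fin n → 𝒳)) : (seqLaw P).real (firstSamples n ⁻¹' B) = mass (pmf P) n B := by
  classical
  have hm := measurable_firstSamples (𝒳 := 𝒳) n
  have : IsProbabilityMeasure ((seqLaw P).map (firstSamples n)) :=
    Measure.isProbabilityMeasure_map hm.aemeasurable
  rw [← map_measureReal_apply hm B.toFinite.measurableSet, mass]
  have hB : B = ((Finset.univ.filter (· ∈ B) : Finset (Fin n → 𝒳)) : Set (Fin n → 𝒳)) := by
    ext; simp
  conv_lhs => rw [hB, ← sum_measureReal_singleton]
  rw [Finset.sum_filter]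
  refine Finset.sum_congr rfl fun y _ => ?_
  rw [map_measureReal_apply hm (measurableSet_singleton y), seqLaw_singleton, Set.indicator_apply]

/-- Finiteness of the alphabet makes every subset of 𝒳ⁿ measurable. -/
lemma measurableSet_sampleFiltration_iff {n : ℕ} {S : Set (ℕ → 𝒳)} :
    MeasurableSet[sampleFiltration 𝒳 n] S ↔ ∃ B : Set (Fin n → 𝒳), firstSamples n ⁻¹' B = S := by
  constructor
  · rintro ⟨B, -, h⟩
    exact ⟨B, h⟩
  · rintro ⟨B, h⟩
    exact ⟨B, B.toFinite.measurableSet, h⟩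

lemma measurableSet_firstSamples {k n : ℕ} (h : k ≤ n) (B : Set (Fin k → 𝒳)) :
    MeasurableSet[sampleFiltration 𝒳 n] (firstSamples k ⁻¹' B) :=
  (sampleFiltration 𝒳).mono h _ (measurableSet_sampleFiltration_iff.2 ⟨B, rfl⟩)

/-- Up to time `n` the acceptance of `H₂` depends on the first `n` samples only. -/
lemma exists_preimage_eq_accept₂ (T : HypTest 𝒳) (n : ℕ) : ∃ B : Set (Fin n → 𝒳),
    firstSamples n ⁻¹' B = T.accept₂ ∩ {x | T.τ x ≤ n} := by
  rw [← measurableSet_sampleFiltration_iff]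
  have : T.accept₂ ∩ {x | T.τ x ≤ n} =
      ⋃ k ∈ Finset.range (n + 1), {x | T.τ x = k} ∩ firstSamples k ⁻¹' (T.A₂ k) := by
    ext x
    simp only [HypTest.accept₂, Set.mem_inter_iff, Set.mem_ofPred_eq, Set.mem_iUnion,
      Finset.mem_range, exists_prop, Set.mem_preimage, Nat.lt_succ_iff]
    constructor
    · rintro ⟨⟨k, hk, hA⟩, hn⟩
      rw [hk] at hn
      exact ⟨k, by exact_mod_cast hn, hk, hA⟩
    · rintro ⟨k, hkn, hk, hA⟩
      exact ⟨⟨k, hk, hA⟩, by rw [hk]; exact_mod_cast hkn⟩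
  rw [this]
  refine Finset.measurableSet_biUnion _ fun k hk => ?_
  have hkn : k ≤ n := Nat.lt_succ_iff.1 (Finset.mem_range.1 hk)
  exact ((sampleFiltration 𝒳).mono hkn _ (T.isStoppingTime.measurableSet_eq_of_countable k)).inter
    (measurableSet_firstSamples hkn _)

lemma mem_accept₁_or_mem_accept₂ (T : HypTest 𝒳) {x : ℕ → 𝒳} {n : ℕ} (h : T.τ x ≤ n) :
    x ∈ T.accept₁ ∨ x ∈ T.accept₂ := by
  obtain ⟨k, hk⟩ := WithTop.ne_top_iff_exists.1 (ne_top_of_le_ne_top (WithTop.coe_ne_top) h)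
  by_cases hA : (fun i : Fin k => x i) ∈ T.A₁ k
  · exact Or.inl ⟨k, hk.symm, hA⟩
  · exact Or.inr ⟨k, hk.symm, hA⟩

/-- Truncating a test at time `n`, with acceptance of `H₁` if it has not stopped by then. -/
lemma exists_truncation₁ (P₁ P₂ : Measure 𝒳) [IsProbabilityMeasure P₁] [IsProbabilityMeasure P₂]
    (T : HypTest 𝒳) (n : ℕ) : ∃ B : Set (Fin n → 𝒳),
    mass (pmf P₁) n Bᶜ ≤ (seqLaw P₁).real T.accept₂ ∧
    mass (pmf P₂) n B ≤ (seqLaw P₂).real T.accept₁ + (seqLaw P₂).real {x | n < T.τ x} := by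
  obtain ⟨B, hB⟩ := exists_preimage_eq_accept₂ T n
  -- `B` records acceptance of H₂ by time n. Its complement adds no error under `P₁`, and under `P₂`
  -- only the runs longer than n.
  refine ⟨Bᶜ, ?_, ?_⟩
  · rw [compl_compl, ← seqLaw_real_preimage, hB]
    exact measureReal_mono Set.inter_subset_left
  · rw [← seqLaw_real_preimage, Set.preimage_compl, hB]
    refine (measureReal_mono ?_).trans (measureReal_union_le _ _)
    intro x hx
    by_cases h : T.τ x ≤ n
    · exact Or.inl ((mem_accept₁_or_mem_accept₂ T h).resolve_right fun h₂ => hx ⟨h₂, h⟩)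
    · exact Or.inr (not_le.1 h)

/-- The test with the roles of the hypotheses exchanged. -/
def HypTest.swap (T : HypTest 𝒳) : HypTest 𝒳 where
  τ := T.τ
  isStoppingTime := T.isStoppingTime
  A₁ := T.A₂

lemma HypTest.swap_accept₁ (T : HypTest 𝒳) : T.swap.accept₁ = T.accept₂ := rfl

lemma HypTest.swap_accept₂ (T : HypTest 𝒳) : T.swap.accept₂ = T.accept₁ := by
  simp [HypTest.accept₁, HypTest.accept₂, HypTest.A₂, HypTest.swap]

/-- The test that stops after `n` samples if they lie in `S`, accepting `H₁` if they lie in `B`,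
and otherwise stops after `m` samples, accepting `H₁` if these lie in `C`. -/
noncomputable def twoStage {n m : ℕ} (hnm : n ≤ m) (S B : Set (Fin n → 𝒳))
    (C : Set (Fin m → 𝒳)) : HypTest 𝒳 where
  τ x := by
    classical
    exact if firstSamples n x ∈ S then (n : WithTop ℕ) else (m : WithTop ℕ)
  isStoppingTime i := by
    rcases lt_or_ge i n with h | h
    · convert MeasurableSet.empty
      ext x
      simp only [Set.mem_ofPred_eq, Set.mem_empty_iff_false, iff_false, not_le]
      split_ifs
      · exact WithTop.coe_lt_coe.2 h
      · exact WithTop.coe_lt_coe.2 (h.trans_le hnm)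
    rcases lt_or_ge i m with h' | h'
    · convert measurableSet_firstSamples h S
      ext x
      simp only [Set.mem_ofPred_eq, Set.mem_preimage]
      split_ifs with hS
      · simp [hS, h]
      · simp [hS, h']
    · convert MeasurableSet.univ
      ext x
      simp only [Set.mem_ofPred_eq, Set.mem_univ, iff_true]
      split_ifs
      · exact WithTop.coe_le_coe.2 h
      · exact WithTop.coe_le_coe.2 h'
  -- If n = m, both clauses concern the same k and the region is the union of `B` and `C`.
  A₁ k := {y | (∃ h : n = k, (fun i => y (Fin.cast h i)) ∈ B) ∨
    (∃ h : m = k, (fun i => y (Fin.cast h i)) ∈ C)}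

section TwoStage

variable {n m : ℕ} (hnm : n ≤ m) (S B : Set (Fin n → 𝒳)) (C : Set (Fin m → 𝒳))

lemma twoStage_τ_le (x : ℕ → 𝒳) : (twoStage hnm S B C).τ x ≤ m := by
  simp only [twoStage]
  split_ifs <;> norm_cast

lemma lt_twoStage_τ_subset :
    {x | n < (twoStage hnm S B C).τ x} ⊆ firstSamples n ⁻¹' Sᶜ := by
  intro x hx hS
  have hS : firstSamples n x ∈ S := hS
  simp [twoStage, hS] at hx

lemma twoStage_accept₁_subset :
    (twoStage hnm S B C).accept₁ ⊆ firstSamples n ⁻¹' B ∪ firstSamples m ⁻¹' C := by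
  rintro x ⟨k, -, ⟨rfl, hB⟩ | ⟨rfl, hC⟩⟩
  · exact Or.inl hB
  · exact Or.inr hC

lemma twoStage_accept₂_subset :
    (twoStage hnm S B C).accept₂ ⊆ firstSamples n ⁻¹' (S \ B) ∪ firstSamples m ⁻¹' Cᶜ := by
  rintro x ⟨k, hk, hA⟩
  simp only [HypTest.A₂, twoStage, Set.mem_compl_iff, Set.mem_ofPred_eq, not_or] at hA hk
  split_ifs at hk with hS
  · obtain rfl : n = k := by exact_mod_cast hk
    exact Or.inl ⟨hS, fun hB => hA.1 ⟨rfl, hB⟩⟩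
  · obtain rfl : m = k := by exact_mod_cast hk
    exact Or.inr fun hC => hA.2 ⟨rfl, hC⟩

end TwoStage

variable {P₁ P₂ : Measure 𝒳} [IsProbabilityMeasure P₁] [IsProbabilityMeasure P₂]

/-- Postponing the decision to time n loses nothing, so stopping times disappear: truncation gives
one direction, since the late event is null, and a degenerate `twoStage` with both times equal to n
gives the other. -/
lemma mem_fixedLengthRegion_iff {E : ℝ × ℝ} :
    E ∈ fixedLengthRegion P₁ P₂ ↔ ∀ δ : ℝ, 0 < δ → ∃ N : ℕ, ∀ n : ℕ, N ≤ n →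
      ∃ B : Set (Fin n → 𝒳), mass (pmf P₁) n Bᶜ ≤ Real.exp (-(E.1 - δ) * n) ∧
        mass (pmf P₂) n B ≤ Real.exp (-(E.2 - δ) * n) := by
  refine forall₂_congr fun δ _ => exists_congr fun N => forall₂_congr fun n _ => ?_
  constructor
  · rintro ⟨T, -, h₂, he₁, he₂⟩
    obtain ⟨B, hB₁, hB₂⟩ := exists_truncation₁ P₁ P₂ T n
    refine ⟨B, hB₁.trans he₁, hB₂.trans ?_⟩
    have h0 : (seqLaw P₂).real {x | n < T.τ x} = 0 := by
      rw [measureReal_eq_zero_iff]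
      simpa [ae_iff] using h₂
    rwa [h0, add_zero]
  · rintro ⟨B, hB₁, hB₂⟩
    refine ⟨twoStage le_rfl Set.univ B B, ae_of_all _ (twoStage_τ_le _ _ _ _),
      ae_of_all _ (twoStage_τ_le _ _ _ _), ?_, ?_⟩
    · rw [← seqLaw_real_preimage] at hB₁
      refine (measureReal_mono ?_).trans hB₁
      exact (twoStage_accept₂_subset _ _ _ _).trans (by simp [Set.compl_eq_univ_sdiff])
    · rw [← seqLaw_real_preimage] at hB₂
      refine (measureReal_mono ?_).trans hB₂
      exact (twoStage_accept₁_subset _ _ _ _).trans (by simp)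

end Sequences

/-! ### The fixed-length region -/

section FixedLength

variable {𝒳 : Type*} [Fintype 𝒳] [MeasurableSpace 𝒳] [MeasurableSingletonClass 𝒳]
  {P₁ P₂ : Measure 𝒳} [IsProbabilityMeasure P₁] [IsProbabilityMeasure P₂]

lemma tendsto_exp_mul_natCast_of_neg {a : ℝ} (ha : a < 0) :
    Filter.Tendsto (fun n : ℕ => Real.exp (a * n)) Filter.atTop (nhds 0) := by
  simpa [← Real.exp_nat_mul, mul_comm] using
    tendsto_pow_atTop_nhds_zero_of_lt_one (Real.exp_pos a).le (Real.exp_lt_one_iff.2 ha)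

/-- Were both inequalities to fail, change of measure would send the tilted masses of the decision
region and of its complement to 0, although they sum to 1. -/
lemma le_kl_tilted_or_of_mem_fixedLengthRegion (h₁₂ : P₁ ≪ P₂) (h₂₁ : P₂ ≪ P₁) {E : ℝ × ℝ}
    (hE : E ∈ fixedLengthRegion P₁ P₂) (l : ℝ) :
    E.1 ≤ kl (tilted P₁ P₂ l) (pmf P₁) ∨ E.2 ≤ kl (tilted P₁ P₂ l) (pmf P₂) := by
  by_contra! h
  obtain ⟨hE₁, hE₂⟩ := h
  obtain ⟨c₁, hk₁, hc₁⟩ := exists_between hE₁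
  obtain ⟨c₂, hk₂, hc₂⟩ := exists_between hE₂
  -- This δ keeps the combined exponents cᵢ - Eᵢ + δ negative.
  obtain ⟨δ, hδ, hδ'⟩ := exists_between (lt_min (sub_pos.2 hc₁) (sub_pos.2 hc₂))
  obtain ⟨hδ₁, hδ₂⟩ := lt_min_iff.1 hδ'
  have hq := fun x => tilted_nonneg (P₁ := P₁) (P₂ := P₂) l x
  have hs := sum_tilted h₁₂ l
  obtain ⟨r₁, hr₁0, hr₁1, hr₁⟩ := exists_mass_le_exp_mul_mass (pmf_nonneg P₁) hq hs
    (fun x => tilted_eq_zero h₂₁ l) hk₁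
  obtain ⟨r₂, hr₂0, hr₂1, hr₂⟩ := exists_mass_le_exp_mul_mass (pmf_nonneg P₂) hq hs
    (fun x hx => tilted_eq_zero h₂₁ l (pmf_eq_zero_of_ac h₁₂ hx)) hk₂
  obtain ⟨N, hN⟩ := mem_fixedLengthRegion_iff.1 hE δ hδ
  have hlim := ((tendsto_exp_mul_natCast_of_neg (a := c₁ - E.1 + δ) (by linarith)).add
    (tendsto_pow_atTop_nhds_zero_of_lt_one hr₁0 hr₁1)).add
    ((tendsto_exp_mul_natCast_of_neg (a := c₂ - E.2 + δ) (by linarith)).add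
    (tendsto_pow_atTop_nhds_zero_of_lt_one hr₂0 hr₂1))
  simp only [add_zero] at hlim
  refine absurd (ge_of_tendsto hlim (b := (1 : ℝ)) ?_) (by norm_num)
  filter_upwards [Filter.eventually_ge_atTop N] with n hn
  obtain ⟨B, hB₁, hB₂⟩ := hN n hn
  rw [← mass_add_compl (n := n) (B := B) hs, add_comm]
  refine add_le_add ((hr₁ n Bᶜ).trans ?_) ((hr₂ n B).trans ?_)
  · refine add_le_add ((mul_le_mul_of_nonneg_left hB₁ (Real.exp_pos _).le).trans_eq ?_) le_rfl
    rw [← Real.exp_add]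
    ring_nf
  · refine add_le_add ((mul_le_mul_of_nonneg_left hB₂ (Real.exp_pos _).le).trans_eq ?_) le_rfl
    rw [← Real.exp_add]
    ring_nf

/-- Two closed sets of parameters cover [0,1]. Positivity of the exponents puts l = 1 in the first
and l = 0 in the second, where one divergence vanishes; connectedness makes the sets meet. -/
lemma mem_tiltedRegion_of_mem_fixedLengthRegion (h₁₂ : P₁ ≪ P₂) (h₂₁ : P₂ ≪ P₁) {E : ℝ × ℝ}
    (hE : E ∈ fixedLengthRegion P₁ P₂) (h₁ : 0 < E.1) (h₂ : 0 < E.2) :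
    E ∈ tiltedRegion P₁ P₂ := by
  have hor := le_kl_tilted_or_of_mem_fixedLengthRegion h₁₂ h₂₁ hE
  obtain ⟨l, hl, hl₁, hl₂⟩ := isPreconnected_closed_iff.1
    (isPreconnected_Icc (a := (0 : ℝ)) (b := 1))
    {l | E.1 ≤ kl (tilted P₁ P₂ l) (pmf P₁)} {l | E.2 ≤ kl (tilted P₁ P₂ l) (pmf P₂)}
    (isClosed_le continuous_const (continuous_kl_tilted_left h₁₂ h₂₁))
    (isClosed_le continuous_const (continuous_kl_tilted_right h₁₂ h₂₁))
    (fun l _ => hor l)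
    ⟨1, by simp, (hor 1).resolve_right (by rw [kl_tilted_one h₁₂ h₂₁]; exact not_le.2 h₂)⟩
    ⟨0, by simp, (hor 0).resolve_left (by rw [kl_tilted_zero h₁₂ h₂₁]; exact not_le.2 h₁)⟩
  exact ⟨l, hl, hl₁, hl₂⟩

lemma exp_neg_mul_le {a b : ℝ} (h : b ≤ a) (n : ℕ) :
    Real.exp (-a * n) ≤ Real.exp (-b * n) :=
  Real.exp_le_exp.2 (mul_le_mul_of_nonneg_right (neg_le_neg h) n.cast_nonneg)

theorem fixedLengthRegion_eq (h₁₂ : P₁ ≪ P₂) (h₂₁ : P₂ ≪ P₁) :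
    fixedLengthRegion P₁ P₂ = tiltedRegion P₁ P₂ ∪ {E : ℝ × ℝ | E.1 ≤ 0 ∨ E.2 ≤ 0} := by
  ext E
  constructor
  · intro hE
    by_cases h : E.1 ≤ 0 ∨ E.2 ≤ 0
    · exact Or.inr h
    · push Not at h
      exact Or.inl (mem_tiltedRegion_of_mem_fixedLengthRegion h₁₂ h₂₁ hE h.1 h.2)
  · rintro (⟨l, hl, hl₁, hl₂⟩ | h | h) <;>
      refine mem_fixedLengthRegion_iff.2 fun δ hδ => ⟨0, fun n _ => ?_⟩
    · exact ⟨llrRegion P₁ P₂ l n,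
        (mass_compl_llrRegion_le h₁₂ h₂₁ hl.1 n).trans (exp_neg_mul_le (by linarith) n),
        (mass_llrRegion_le h₁₂ h₂₁ hl.2 n).trans (exp_neg_mul_le (by linarith) n)⟩
    -- With one exponent nonpositive, its error bound is at least 1, and a constant decision makes
    -- the other error zero.
    · refine ⟨∅, ?_, by simpa [mass_empty] using (Real.exp_pos _).le⟩
      rw [Set.compl_empty, mass_univ (sum_pmf P₁)]
      exact Real.one_le_exp (mul_nonneg (by linarith) n.cast_nonneg)
    · refine ⟨Set.univ, by simpa [mass_empty] using (Real.exp_pos _).le, ?_⟩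
      rw [mass_univ (sum_pmf P₂)]
      exact Real.one_le_exp (mul_nonneg (by linarith) n.cast_nonneg)

end FixedLength

/-! ### The almost-fixed-length region: converse and achievability -/

section AlmostFixedLength

variable {𝒳 : Type*} [Fintype 𝒳] [MeasurableSpace 𝒳] [MeasurableSingletonClass 𝒳]
  {P₁ P₂ : Measure 𝒳} [IsProbabilityMeasure P₁] [IsProbabilityMeasure P₂]

/-- For large `n` a sum of two exponentials is absorbed by a loss in the exponent. -/
lemma exists_exp_add_exp_le {δ : ℝ} (hδ : 0 < δ) :
    ∃ N : ℕ, ∀ n : ℕ, N ≤ n → ∀ a b c : ℝ, c + δ ≤ a → c + δ ≤ b →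
      Real.exp (-a * n) + Real.exp (-b * n) ≤ Real.exp (-c * n) := by
  obtain ⟨N, hN⟩ := exists_nat_ge (Real.log 2 / δ)
  refine ⟨N, fun n hn a b c ha hb => ?_⟩
  have h2 : (2 : ℝ) ≤ Real.exp (δ * n) := by
    rw [← Real.log_le_iff_le_exp two_pos]
    have : Real.log 2 / δ ≤ n := hN.trans (Nat.cast_le.2 hn)
    rwa [div_le_iff₀' hδ] at this
  calc Real.exp (-a * n) + Real.exp (-b * n)
      ≤ Real.exp (-(c + δ) * n) + Real.exp (-(c + δ) * n) :=
        add_le_add (exp_neg_mul_le ha n) (exp_neg_mul_le hb n)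
    _ = 2 * Real.exp (-(c + δ) * n) := (two_mul _).symm
    _ ≤ Real.exp (δ * n) * Real.exp (-(c + δ) * n) := by gcongr
    _ = Real.exp (-c * n) := by rw [← Real.exp_add]; ring_nf

/-- A test whose exponents are `E` and that stops by time `n` except on an event with exponent `γ`
yields a fixed-length test. -/
lemma min_mem_fixedLengthRegion_right {γ : ℝ} {K : ℕ} {E : ℝ × ℝ}
    (hE : E ∈ almostFixedLengthRegion P₁ P₂ γ K) :
    (E.1, min E.2 γ) ∈ fixedLengthRegion P₁ P₂ := by
  refine mem_fixedLengthRegion_iff.2 fun δ hδ => ?_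
  obtain ⟨N₁, hN₁⟩ := hE (δ / 2) (half_pos hδ)
  obtain ⟨N₂, hN₂⟩ := exists_exp_add_exp_le (half_pos hδ)
  refine ⟨max N₁ N₂, fun n hn => ?_⟩
  obtain ⟨T, -, hγ₂, -, -, he₁, he₂⟩ := hN₁ n ((le_max_left _ _).trans hn)
  obtain ⟨B, hB₁, hB₂⟩ := exists_truncation₁ P₁ P₂ T n
  refine ⟨B, (hB₁.trans he₁).trans (exp_neg_mul_le (by simp only; linarith) n),
    (hB₂.trans (add_le_add he₂ hγ₂)).trans
      (hN₂ n ((le_max_right _ _).trans hn) _ _ _ ?_ ?_)⟩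
  · linarith [min_le_left E.2 γ]
  · linarith [min_le_right E.2 γ]

/-- Mirror image: undecided runs are assigned to H₂ and burden only the error under `P₁`. -/
lemma min_mem_fixedLengthRegion_left {γ : ℝ} {K : ℕ} {E : ℝ × ℝ}
    (hE : E ∈ almostFixedLengthRegion P₁ P₂ γ K) :
    (min E.1 γ, E.2) ∈ fixedLengthRegion P₁ P₂ := by
  refine mem_fixedLengthRegion_iff.2 fun δ hδ => ?_
  obtain ⟨N₁, hN₁⟩ := hE (δ / 2) (half_pos hδ)
  obtain ⟨N₂, hN₂⟩ := exists_exp_add_exp_le (half_pos hδ)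
  refine ⟨max N₁ N₂, fun n hn => ?_⟩
  obtain ⟨T, hγ₁, -, -, -, he₁, he₂⟩ := hN₁ n ((le_max_left _ _).trans hn)
  obtain ⟨B, hB₁, hB₂⟩ := exists_truncation₁ P₂ P₁ T.swap n
  rw [HypTest.swap_accept₂] at hB₁
  rw [HypTest.swap_accept₁] at hB₂
  refine ⟨Bᶜ, ?_, (hB₁.trans he₂).trans (exp_neg_mul_le (by simp only; linarith) n)⟩
  rw [compl_compl]
  refine (hB₂.trans (add_le_add he₁ hγ₁)).trans
      (hN₂ n ((le_max_right _ _).trans hn) _ _ _ ?_ ?_)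
  · linarith [min_le_left E.1 γ]
  · linarith [min_le_right E.1 γ]

/-- Rounding m/K down to n changes the exponent by at most |e|, which is at most δm/2 once m ≥
2|e|/δ. The other half of δm covers the slack δn/2. -/
lemma exp_neg_mul_le_of_div {e δ : ℝ} {K n m N : ℕ} (hK : 1 ≤ K) (hδ : 0 < δ)
    (hN : 2 * |e| / δ ≤ N) (hm : N ≤ m) (hn : n = m / K) :
    Real.exp (-(e - δ / 2) * n) ≤ Real.exp (-(e / K - δ) * m) := by
  have hK0 : (0 : ℝ) < K := by exact_mod_cast hK
  have hK1 : (1 : ℝ) ≤ K := by exact_mod_cast hK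
  have hle : ((n * K : ℕ) : ℝ) ≤ m := by
    exact_mod_cast hn ▸ Nat.div_mul_le_self m K
  have hlt : (m : ℝ) ≤ ((n + 1) * K : ℕ) := by
    have := Nat.lt_div_mul_add (a := m) (b := K) (by omega)
    rw [← hn] at this
    exact_mod_cast (by nlinarith : m ≤ (n + 1) * K)
  push_cast at hle hlt
  have hmN : 2 * |e| ≤ m * δ := by
    rw [div_le_iff₀ hδ] at hN
    exact hN.trans (mul_le_mul_of_nonneg_right (Nat.cast_le.2 hm) hδ.le)
  set s : ℝ := m / K with hs
  have hs₁ : (n : ℝ) ≤ s := (le_div_iff₀ hK0).2 hle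
  have hs₂ : s ≤ n + 1 := (div_le_iff₀ hK0).2 hlt
  have hnm : (n : ℝ) ≤ m := le_trans (le_mul_of_one_le_right n.cast_nonneg hK1) hle
  have he : e * (s - n) ≤ |e| := by
    calc e * (s - n) ≤ |e| * (s - n) :=
          mul_le_mul_of_nonneg_right (le_abs_self e) (by linarith)
      _ ≤ |e| * 1 := mul_le_mul_of_nonneg_left (by linarith) (abs_nonneg e)
      _ = |e| := mul_one _
  refine Real.exp_le_exp.2 ?_
  have h1 : e / K * m = e * s := by rw [hs]; ring
  nlinarith [mul_le_mul_of_nonneg_right hnm hδ.le]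

/-- With m samples available, the test designed for n = ⌊m/K⌋ almost surely stops by Kn ≤ m, so it
is a fixed-length test. -/
lemma inv_smul_mem_fixedLengthRegion {γ : ℝ} {K : ℕ} (hK : 1 ≤ K) {E : ℝ × ℝ}
    (hE : E ∈ almostFixedLengthRegion P₁ P₂ γ K) :
    (K : ℝ)⁻¹ • E ∈ fixedLengthRegion P₁ P₂ := by
  intro δ hδ
  obtain ⟨N, hN⟩ := hE (δ / 2) (half_pos hδ)
  obtain ⟨N₁, hN₁⟩ := exists_nat_ge (2 * |E.1| / δ)
  obtain ⟨N₂, hN₂⟩ := exists_nat_ge (2 * |E.2| / δ)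
  refine ⟨max (N * K) (max N₁ N₂), fun m hm => ?_⟩
  simp only [max_le_iff] at hm
  obtain ⟨T, -, -, hτ₁, hτ₂, he₁, he₂⟩ := hN (m / K) ((Nat.le_div_iff_mul_le hK).2 hm.1)
  have hle : ((K * (m / K) : ℕ) : WithTop ℕ) ≤ (m : WithTop ℕ) :=
    WithTop.coe_le_coe.2 (Nat.mul_div_le m K)
  refine ⟨T, hτ₁.mono fun x hx => hx.trans hle, hτ₂.mono fun x hx => hx.trans hle, ?_, ?_⟩
  · refine (he₁.trans (exp_neg_mul_le_of_div hK hδ hN₁ hm.2.1 rfl)).trans_eq ?_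
    simp [div_eq_inv_mul]
  · refine (he₂.trans (exp_neg_mul_le_of_div hK hδ hN₂ hm.2.2 rfl)).trans_eq ?_
    simp [div_eq_inv_mul]

theorem almostFixedLengthRegion_subset (h₁₂ : P₁ ≪ P₂) (h₂₁ : P₂ ≪ P₁) {γ : ℝ} {K : ℕ}
    (hK : 1 ≤ K) (hγ : 0 < γ) :
    almostFixedLengthRegion P₁ P₂ γ K ⊆
      Rγ P₁ P₂ γ ∩ (K : ℝ) • fixedLengthRegion P₁ P₂ := by
  intro E hE
  refine ⟨?_, (Set.mem_smul_set_iff_inv_smul_mem₀ (by positivity) _ _).2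
    (inv_smul_mem_fixedLengthRegion hK hE)⟩
  by_cases hFL : E ∈ fixedLengthRegion P₁ P₂
  · exact Or.inl hFL
  refine Or.inr ?_
  rw [fixedLengthRegion_eq h₁₂ h₂₁] at hFL
  simp only [Set.mem_union, Set.mem_ofPred_eq, not_or, not_le] at hFL
  obtain ⟨hT, hE₁, hE₂⟩ := hFL
  constructor
  -- Here γ > 0 makes the minimum positive. The minimum cannot be bounded through E₂, since that
  -- would put E in the tilted region; hence γ is below the divergence and l is admissible for `E₁`.
  · obtain ⟨l, hl, hl₁, hl₂⟩ := mem_tiltedRegion_of_mem_fixedLengthRegion h₁₂ h₂₁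
      (min_mem_fixedLengthRegion_right hE) hE₁ (lt_min hE₂ hγ)
    rcases min_le_iff.1 hl₂ with h | h
    · exact absurd ⟨l, hl, hl₁, h⟩ hT
    · exact le_trans (EReal.coe_le_coe_iff.2 hl₁) (le_sSup ⟨l, hl, h, rfl⟩)
  · obtain ⟨l, hl, hl₁, hl₂⟩ := mem_tiltedRegion_of_mem_fixedLengthRegion h₁₂ h₂₁
      (min_mem_fixedLengthRegion_left hE) (lt_min hE₁ hγ) hE₂
    rcases min_le_iff.1 hl₁ with h | h
    · exact absurd ⟨l, hl, h, hl₂⟩ hT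
    · exact le_trans (EReal.coe_le_coe_iff.2 hl₂) (le_sSup ⟨l, hl, h, rfl⟩)

/-- A near-maximizer suffices, as exponents are only needed up to δ, so attainment is never used. An
empty set has supremum ⊥ and contradicts the hypothesis. -/
lemma exists_lt_of_le_sSup {p : ℝ → Prop} {f : ℝ → ℝ} {a b : ℝ} (hab : b < a)
    (h : (a : EReal) ≤ sSup {e : EReal | ∃ l ∈ Set.Icc (0 : ℝ) 1, p l ∧ e = (f l : EReal)}) :
    ∃ l ∈ Set.Icc (0 : ℝ) 1, p l ∧ b < f l := by
  obtain ⟨_, ⟨l, hl, hp, rfl⟩, hb⟩ := lt_sSup_iff.1 ((EReal.coe_lt_coe_iff.2 hab).trans_le h)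
  exact ⟨l, hl, hp, EReal.coe_lt_coe_iff.1 hb⟩

lemma seqLaw_lt_twoStage_τ (P : Measure 𝒳) [IsProbabilityMeasure P] {n m : ℕ} (hnm : n ≤ m)
    (S B : Set (Fin n → 𝒳)) (C : Set (Fin m → 𝒳)) :
    (seqLaw P).real {x | n < (twoStage hnm S B C).τ x} ≤ mass (pmf P) n Sᶜ := by
  rw [← seqLaw_real_preimage]
  exact measureReal_mono (lt_twoStage_τ_subset hnm S B C)

lemma seqLaw_twoStage_accept₁_le (P : Measure 𝒳) [IsProbabilityMeasure P] {n m : ℕ}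
    (hnm : n ≤ m) (S B : Set (Fin n → 𝒳)) (C : Set (Fin m → 𝒳)) :
    (seqLaw P).real (twoStage hnm S B C).accept₁ ≤ mass (pmf P) n B + mass (pmf P) m C := by
  rw [← seqLaw_real_preimage, ← seqLaw_real_preimage]
  exact (measureReal_mono (twoStage_accept₁_subset hnm S B C)).trans (measureReal_union_le _ _)

lemma seqLaw_twoStage_accept₂_le (P : Measure 𝒳) [IsProbabilityMeasure P] {n m : ℕ}
    (hnm : n ≤ m) (S B : Set (Fin n → 𝒳)) (C : Set (Fin m → 𝒳)) :
    (seqLaw P).real (twoStage hnm S B C).accept₂ ≤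
      mass (pmf P) n (S \ B) + mass (pmf P) m Cᶜ := by
  rw [← seqLaw_real_preimage, ← seqLaw_real_preimage]
  exact (measureReal_mono (twoStage_accept₂_subset hnm S B C)).trans (measureReal_union_le _ _)

lemma fixedLengthRegion_subset_almostFixedLengthRegion {γ : ℝ} {K : ℕ} (hK : 1 ≤ K) :
    fixedLengthRegion P₁ P₂ ⊆ almostFixedLengthRegion P₁ P₂ γ K := by
  intro E hE δ hδ
  obtain ⟨N, hN⟩ := hE δ hδ
  refine ⟨N, fun n hn => ?_⟩
  obtain ⟨T, hτ₁, hτ₂, he₁, he₂⟩ := hN n hn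
  have hle : (n : WithTop ℕ) ≤ ((K * n : ℕ) : WithTop ℕ) :=
    WithTop.coe_le_coe.2 (Nat.le_mul_of_pos_left n hK)
  have h0 : ∀ {P : Measure 𝒳} [IsProbabilityMeasure P], (∀ᵐ x ∂(seqLaw P), T.τ x ≤ n) →
      (seqLaw P).real {x | n < T.τ x} ≤ Real.exp (-γ * n) := by
    intro P _ hP
    have : (seqLaw P).real {x | n < T.τ x} = 0 := by
      rw [measureReal_eq_zero_iff]
      simpa [ae_iff] using hP
    exact this.trans_le (Real.exp_pos _).le
  exact ⟨T, h0 hτ₁, h0 hτ₂, hτ₁.mono fun x hx => hx.trans hle,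
    hτ₂.mono fun x hx => hx.trans hle, he₁, he₂⟩

theorem subset_almostFixedLengthRegion (h₁₂ : P₁ ≪ P₂) (h₂₁ : P₂ ≪ P₁) {γ : ℝ} {K : ℕ}
    (hK : 1 ≤ K) :
    Rγ P₁ P₂ γ ∩ (K : ℝ) • fixedLengthRegion P₁ P₂ ⊆ almostFixedLengthRegion P₁ P₂ γ K := by
  rintro E ⟨hFL | ⟨hE₁, hE₂⟩, hKE⟩
  · exact fixedLengthRegion_subset_almostFixedLengthRegion hK hFL
  intro δ hδ
  obtain ⟨l₁, hl₁, hγ₁, hk₁⟩ := exists_lt_of_le_sSup (sub_lt_self E.1 (half_pos hδ)) hE₁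
  obtain ⟨l₂, hl₂, hγ₂, hk₂⟩ := exists_lt_of_le_sSup (sub_lt_self E.2 (half_pos hδ)) hE₂
  obtain ⟨E', hE', rfl⟩ := hKE
  have hK0 : (0 : ℝ) < K := by exact_mod_cast hK
  -- A loss of δ/(2K) per sample over Kn samples amounts to δ/2 per unit of n.
  obtain ⟨N, hN⟩ := mem_fixedLengthRegion_iff.1 hE' (δ / 2 / K) (by positivity)
  obtain ⟨M, hM⟩ := exists_exp_add_exp_le (half_pos hδ)
  refine ⟨max N M, fun n hn => ?_⟩
  have hnm : n ≤ K * n := Nat.le_mul_of_pos_left n hK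
  obtain ⟨C, hC₁, hC₂⟩ := hN (K * n) (((le_max_left _ _).trans hn).trans hnm)
  have hexp : ∀ e : ℝ, Real.exp (-(e - δ / 2 / K) * (K * n : ℕ)) =
      Real.exp (-(K * e - δ / 2) * n) := fun e => by
    push_cast
    congr 1
    field_simp
  rw [hexp] at hC₁ hC₂
  set B₁ := llrRegion P₁ P₂ l₁ n
  set B₂ := llrRegion P₁ P₂ l₂ n
  have hp₁ := pmf_nonneg P₁
  have hp₂ := pmf_nonneg P₂
  -- At time n accept H₁ on `B₂`, accept H₂ on the rest of `B₁ᶜ`, and otherwise continue. Continuing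
  -- lies in `B₂ᶜ`, rare under `P₁`, and in `B₁`, rare under `P₂`. No order between l₁ and l₂ is
  -- needed, as `B₂` takes precedence on an overlap.
  refine ⟨twoStage hnm (B₂ ∪ B₁ᶜ) B₂ C, ?_, ?_, ae_of_all _ (twoStage_τ_le _ _ _ _),
    ae_of_all _ (twoStage_τ_le _ _ _ _), ?_, ?_⟩
  · refine (seqLaw_lt_twoStage_τ P₁ hnm _ _ _).trans ?_
    refine (mass_mono hp₁ (C := B₂ᶜ) ?_).trans
      ((mass_compl_llrRegion_le h₁₂ h₂₁ hl₂.1 n).trans (exp_neg_mul_le hγ₂ n))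
    exact Set.compl_subset_compl.2 Set.subset_union_left
  · refine (seqLaw_lt_twoStage_τ P₂ hnm _ _ _).trans ?_
    refine (mass_mono hp₂ (C := B₁) ?_).trans
      ((mass_llrRegion_le h₁₂ h₂₁ hl₁.2 n).trans (exp_neg_mul_le hγ₁ n))
    exact Set.compl_subset_comm.1 Set.subset_union_right
  · refine (seqLaw_twoStage_accept₂_le P₁ hnm _ _ _).trans ((add_le_add
      ((mass_mono hp₁ (C := B₁ᶜ) ?_).trans (mass_compl_llrRegion_le h₁₂ h₂₁ hl₁.1 n)) hC₁).trans
      (hM n ((le_max_right _ _).trans hn) _ _ _ ?_ ?_))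
    · exact fun y hy => hy.1.resolve_left hy.2
    · linarith
    · simp only [Prod.smul_fst, smul_eq_mul]
      linarith
  · refine (seqLaw_twoStage_accept₁_le P₂ hnm _ _ _).trans ((add_le_add
      (mass_llrRegion_le h₁₂ h₂₁ hl₂.2 n) hC₂).trans
      (hM n ((le_max_right _ _).trans hn) _ _ _ ?_ ?_))
    · linarith
    · simp only [Prod.smul_snd, smul_eq_mul]
      linarith

end AlmostFixedLength

end AFLTest

theorem mainTheorem2 {𝒳 : Type*} [Fintype 𝒳] [MeasurableSpace 𝒳] [MeasurableSingletonClass 𝒳]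
    (P₁ P₂ : Measure 𝒳) [IsProbabilityMeasure P₁] [IsProbabilityMeasure P₂]
    (h₁₂ : P₁ ≪ P₂) (h₂₁ : P₂ ≪ P₁) :
    AFLTest.fixedLengthRegion P₁ P₂ =
      AFLTest.tiltedRegion P₁ P₂ ∪ {E : ℝ × ℝ | E.1 ≤ 0 ∨ E.2 ≤ 0} ∧
    ∀ (γ : ℝ) (K : ℕ), 0 ≤ γ → 1 ≤ K →
      AFLTest.Rγ P₁ P₂ γ ∩ (K : ℝ) • AFLTest.fixedLengthRegion P₁ P₂ ⊆
          AFLTest.almostFixedLengthRegion P₁ P₂ γ K ∧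
      (0 < γ →
        AFLTest.almostFixedLengthRegion P₁ P₂ γ K ⊆
          AFLTest.Rγ P₁ P₂ γ ∩ (K : ℝ) • AFLTest.fixedLengthRegion P₁ P₂) := by
  exact ⟨AFLTest.fixedLengthRegion_eq h₁₂ h₂₁, fun _ _ _ hK =>
    ⟨AFLTest.subset_almostFixedLengthRegion h₁₂ h₂₁ hK,
      AFLTest.almostFixedLengthRegion_subset h₁₂ h₂₁ hK⟩⟩
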